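/- **Corollary 2.11.** Let $\mathcal H$ and $\mathcal K$ be complex Hilbert spaces, let $\Phi:\mathbb B(\mathcal H)\to\mathbb B(\mathcal K)$ be a positive linear map (that is, $\Phi(X)\ge 0$ whenever $X\ge 0$) with $\Phi(I)=I$, let $0<m\le M$ and $p>0$ be real numbers, and let $A,B\in\mathbb B(\mathcal H)$ satisfy $mI\le A\le MI$ and $mI\le B\le MI$. For positive invertible operators $X,Y$ write $$X\nabla Y=\frac{X+Y}{2},\qquad X\sharp Y=X^{1/2}\bigl(X^{-1/2}YX^{-1/2}\bigr)^{1/2}X^{1/2},$$ write $\Phi^p(X)=(\Phi(X))^p$, and put $$\alpha=\max\left\{\frac{(M+m)^2}{4Mm},\ \frac{(M+m)^2}{4^{2/p}Mm}\right\}.$$ Then $$\Phi^p\left(\frac{A+B}{2}+Mm\bigl(A^{-1}\nabla B^{-1}-A^{-1}\sharp B^{-1}\bigr)\right)\le\alpha^p\,\Phi^p(A\sharp B)$$ and $$\Phi^p\left(\frac{A+B}{2}+Mm\bigl(A^{-1}\nabla B^{-1}-A^{-1}\sharp B^{-1}\bigr)\right)\le\alpha^p\,\bigl(\Phi(A)\sharp\Phi(B)\bigr)^p.$$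 -/

import Mathlib

noncomputable section

/-- The weighted arithmetic mean `A ∇_ν B = (1 - ν) A + ν B` of two bounded operators. -/
def opArithMean {H : Type*} [NormedAddCommGroup H] [InnerProductSpace ℂ H]
    (ν : ℝ) (A B : H →L[ℂ] H) : H →L[ℂ] H :=
  (1 - ν) • A + ν • B

/-- The weighted geometric mean `A ♯_ν B = A^{1/2} (A^{-1/2} B A^{-1/2})^ν A^{1/2}` of two positive
invertible operators; real powers are those of the continuous functional calculus. -/
def opGeomMean {H : Type*} [NormedAddCommGroup H] [InnerProductSpace ℂ H] [CompleteSpace H]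
    (ν : ℝ) (A B : H →L[ℂ] H) : H →L[ℂ] H :=
  A ^ (1 / 2 : ℝ) * (A ^ (-(1 / 2) : ℝ) * B * A ^ (-(1 / 2) : ℝ)) ^ ν * A ^ (1 / 2 : ℝ)

/-- The constant `α = max {(M + m)² / (4 M m), (M + m)² / (4^{2/p} M m)}`. -/
def amgmConst (m M p : ℝ) : ℝ :=
  max ((M + m) ^ 2 / (4 * M * m)) ((M + m) ^ 2 / ((4 : ℝ) ^ (2 / p) * M * m))

end

open Polynomial

section CStar

variable {𝒜 : Type*} [CStarAlgebra 𝒜] [PartialOrder 𝒜] [StarOrderedRing 𝒜]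
variable {ℬ : Type*} [CStarAlgebra ℬ] [PartialOrder ℬ] [StarOrderedRing ℬ]

/-! Averaging `a + M m a⁻¹ ≤ M + m`, which is `(M - a)(a - m) ≥ 0` divided by `a`, with its analogue
for `b`, and using `a⁻¹ ♯ b⁻¹ = (a ♯ b)⁻¹`, gives `X + M m (a ♯ b)⁻¹ ≤ M + m`, where `X` is the
refined arithmetic mean. Apply `Φ`. If `g ≥ Φ(a ♯ b)`, Choi's inequality yields `Φ(X) + M m g⁻¹ ≤ M
+ m`. The Bhatia–Kittaneh inequality turns this additive bound into a comparison of `p`-th powers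
for `p ≥ 2`, and Löwner–Heinz descends from `p = 2` to smaller exponents. The two claims are `g =
Φ(a ♯ b)` and, by Ando's inequality, `g = Φ(a) ♯ Φ(b)`.

Choi's and Ando's inequalities both come from a weighted Kadison inequality, `Φ(ada) Φ(a²)⁻¹ Φ(ada)
≤ Φ(ad²a)` when `Φ(a²)` is invertible. It needs only positivity of `Φ`: Bernstein polynomials of `d`
serve as a discrete spectral measure. -/

/-! ### Weighted Kadison inequality -/

/-- A real polynomial that is nonnegative on `[0, 1]` is nonnegative at `0 ≤ d ≤ 1`. -/
lemma aeval_nonneg_of_mem_Icc {d : 𝒜} (hd : 0 ≤ d) (hd1 : d ≤ 1) {q : ℝ[X]}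
    (hq : ∀ x ∈ Set.Icc (0 : ℝ) 1, 0 ≤ q.eval x) : 0 ≤ aeval d q := by
  have hsa : IsSelfAdjoint d := .of_nonneg hd
  rw [← cfc_polynomial q d]
  refine cfc_nonneg fun x hx ↦ hq x ⟨spectrum_nonneg_of_nonneg hd hx, ?_⟩
  have : d ≤ algebraMap ℝ 𝒜 1 := by simpa using hd1
  exact (le_algebraMap_iff_spectrum_le (ha := hsa)).1 this x hx

lemma bernsteinPolynomial_eval_nonneg (n ν : ℕ) {x : ℝ} (hx : x ∈ Set.Icc (0 : ℝ) 1) :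
    0 ≤ (bernsteinPolynomial ℝ n ν).eval x := by
  have h0 := hx.1
  have h1 := sub_nonneg.2 hx.2
  simp only [bernsteinPolynomial, eval_mul, eval_natCast, eval_pow, eval_X, eval_sub, eval_one]
  positivity

lemma conj_nonneg_of_isSelfAdjoint {a x : 𝒜} (ha : IsSelfAdjoint a) (hx : 0 ≤ x) :
    0 ≤ a * x * a := by
  simpa [ha.star_eq] using star_left_conjugate_nonneg hx a

/-- The finite-level estimate behind Kadison's inequality, obtained from Bernstein polynomials. -/
lemma PositiveLinearMap.kadison_bernstein (Φ : 𝒜 →ₚ[ℂ] ℬ) {a d : 𝒜} (ha : IsSelfAdjoint a)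
    (hd : 0 ≤ d) (hd1 : d ≤ 1) {v : ℬ} (hv : Φ (a * a) * v = Φ (a * d * a)) (n : ℕ) :
    (n : ℝ) • (n : ℝ) • (star v * Φ (a * a) * v)
      ≤ (n : ℝ) • ((n : ℝ) - 1) • Φ (a * (d * d) * a) + (n : ℝ) • Φ (a * d * a) := by
  let L : ℝ[X] →ₗ[ℝ] ℬ :=
    { toFun := fun q ↦ Φ (a * aeval d q * a)
      map_add' := fun q r ↦ by simp [mul_add, add_mul]
      map_smul' := fun c q ↦ by
        simp only [map_smul, mul_smul_comm, smul_mul_assoc, RingHom.id_apply]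
        exact map_real_smul (Φ : 𝒜 →ₚ[ℂ] ℬ) (map_continuous Φ) c _ }
  have hL (q) : L q = Φ (a * aeval d q * a) := rfl
  let E : ℕ → ℬ := fun ν ↦ L (bernsteinPolynomial ℝ n ν)
  have hE (ν) : 0 ≤ E ν := map_nonneg Φ <| conj_nonneg_of_isSelfAdjoint ha <|
    aeval_nonneg_of_mem_Icc hd hd1 fun x hx ↦ bernsteinPolynomial_eval_nonneg n ν hx
  have h0 : ∑ ν ∈ Finset.range (n + 1), E ν = Φ (a * a) := by
    rw [← map_sum, bernsteinPolynomial.sum, hL]; simp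
  have h1 : ∑ ν ∈ Finset.range (n + 1), (ν : ℝ) • E ν = (n : ℝ) • Φ (a * d * a) := by
    have := congrArg L (bernsteinPolynomial.sum_smul ℝ n)
    simp only [map_sum, ← Nat.cast_smul_eq_nsmul ℝ, map_smul] at this
    rw [this, hL, aeval_X]
  have h2 : ∑ ν ∈ Finset.range (n + 1), ((ν : ℝ) * (ν : ℝ)) • E ν
      = (n : ℝ) • ((n : ℝ) - 1) • Φ (a * (d * d) * a) + (n : ℝ) • Φ (a * d * a) := by
    have := congrArg L (bernsteinPolynomial.sum_mul_smul ℝ n)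
    -- Truncated subtraction is harmless: at `k = 0` the factor `k` vanishes.
    have hc (k : ℕ) : ((k * (k - 1) : ℕ) : ℝ) = (k : ℝ) * ((k : ℝ) - 1) := by
      cases k <;> simp
    simp only [map_sum, ← Nat.cast_smul_eq_nsmul ℝ, map_smul, hc] at this
    rw [smul_smul, ← h1, ← pow_two d]
    rw [hL (X ^ 2)] at this
    simp only [map_pow, aeval_X] at this
    rw [← this, ← Finset.sum_add_distrib]
    refine Finset.sum_congr rfl fun ν _ ↦ ?_
    rw [← add_smul]
    congr 1
    ring
  have hsa : star v * Φ (a * a) = Φ (a * d * a) := by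
    have e1 : IsSelfAdjoint (Φ (a * a)) :=
      .of_nonneg (map_nonneg Φ (by simpa [ha.star_eq] using star_mul_self_nonneg a))
    have e2 : IsSelfAdjoint (Φ (a * d * a)) :=
      .of_nonneg (map_nonneg Φ (conj_nonneg_of_isSelfAdjoint ha hd))
    rw [← e2.star_eq, ← hv, star_mul, e1.star_eq]
  -- A variance is nonnegative: the `E ν` act as positive operator weights at the points `ν`, with
  -- `n • v` as the mean. Only the moments of order 0, 1 and 2 enter.
  have key : 0 ≤ ∑ ν ∈ Finset.range (n + 1),
      star ((ν : ℝ) • 1 - (n : ℝ) • v) * E ν * ((ν : ℝ) • 1 - (n : ℝ) • v) :=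
    Finset.sum_nonneg fun ν _ ↦ star_left_conjugate_nonneg (hE ν) _
  have expand (ν : ℕ) : star ((ν : ℝ) • 1 - (n : ℝ) • v) * E ν * ((ν : ℝ) • 1 - (n : ℝ) • v)
      = ((ν : ℝ) * (ν : ℝ)) • E ν - (n : ℝ) • (((ν : ℝ) • E ν) * v)
        - (n : ℝ) • (star v * ((ν : ℝ) • E ν)) + (n : ℝ) • (n : ℝ) • (star v * E ν * v) := by
    simp only [star_sub, star_smul, star_one, star_trivial, sub_mul, mul_sub, smul_mul_assoc,
      mul_smul_comm, one_mul, mul_one, smul_smul, mul_assoc]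
    module
  simp only [expand, Finset.sum_add_distrib, Finset.sum_sub_distrib, ← Finset.smul_sum,
    ← Finset.sum_mul, ← Finset.mul_sum, h0, h1, h2] at key
  -- Both cross terms equal `star v * Φ (a * a) * v`, so one copy survives with a minus sign.
  have hcomm : star v * Φ (a * d * a) = Φ (a * d * a) * v := by
    rw [← hv, ← mul_assoc (star v), hsa, hv]
  rw [smul_mul_assoc, mul_smul_comm, hcomm, hsa] at key
  rw [← sub_nonneg, hsa]
  refine key.trans_eq ?_
  module

/-- Kadison's inequality for a positive map, weighted by `a` and restricted to `d ≥ 0`. -/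
lemma PositiveLinearMap.kadison_of_le_one (Φ : 𝒜 →ₚ[ℂ] ℬ) {a d : 𝒜} (ha : IsSelfAdjoint a)
    (hd : 0 ≤ d) (hd1 : d ≤ 1) {v : ℬ} (hv : Φ (a * a) * v = Φ (a * d * a)) :
    star v * Φ (a * a) * v ≤ Φ (a * (d * d) * a) := by
  have bound (n : ℕ) : star v * Φ (a * a) * v ≤ Φ (a * (d * d) * a)
      + (1 / ((n : ℝ) + 1)) • (Φ (a * d * a) - Φ (a * (d * d) * a)) := by
    -- Degree `n + 1` keeps the division by its square legitimate; the error is then of order `1 /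
    -- (n + 1)`.
    have h := Φ.kadison_bernstein ha hd hd1 hv (n + 1)
    have hn : (0 : ℝ) < (n : ℝ) + 1 := by positivity
    have h' := smul_le_smul_of_nonneg_left h
      (by positivity : 0 ≤ 1 / (((n : ℝ) + 1) * ((n : ℝ) + 1)))
    push_cast at h'
    refine (le_of_eq ?_).trans (h'.trans_eq ?_)
    · rw [smul_smul, smul_smul]
      have : 1 / (((n : ℝ) + 1) * ((n : ℝ) + 1)) * ((n : ℝ) + 1) * ((n : ℝ) + 1) = 1 := by
        field_simp
      rw [this, one_smul]
    · match_scalars <;> field_simp; ring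
  refine ge_of_tendsto' (x := Filter.atTop) ?_ bound
  have := (tendsto_one_div_add_atTop_nhds_zero_nat (𝕜 := ℝ)).smul_const
    (Φ (a * d * a) - Φ (a * (d * d) * a))
  simpa using this.const_add (Φ (a * (d * d) * a))

lemma PositiveLinearMap.map_smul_real (Φ : 𝒜 →ₚ[ℂ] ℬ) (c : ℝ) (x : 𝒜) : Φ (c • x) = c • Φ x :=
  map_real_smul (Φ : 𝒜 →ₚ[ℂ] ℬ) (map_continuous Φ) c x

/-- Replacing `d` by `c • d` and `v` by `c • v` preserves the hypothesis and scales both sides by `c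
^ 2`, so `d ≤ 1` can be arranged. -/
lemma PositiveLinearMap.kadison (Φ : 𝒜 →ₚ[ℂ] ℬ) {a d : 𝒜} (ha : IsSelfAdjoint a)
    (hd : 0 ≤ d) {v : ℬ} (hv : Φ (a * a) * v = Φ (a * d * a)) :
    star v * Φ (a * a) * v ≤ Φ (a * (d * d) * a) := by
  have hN : 0 < ‖d‖ + 1 := by positivity
  set c : ℝ := (‖d‖ + 1)⁻¹ with hc
  have hc0 : 0 < c := inv_pos.2 hN
  have hd1 : c • d ≤ 1 := by
    have h1 : d ≤ algebraMap ℝ 𝒜 (‖d‖ + 1) :=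
      (IsSelfAdjoint.le_algebraMap_norm_self (.of_nonneg hd)).trans
        (algebraMap_mono 𝒜 (by linarith))
    have h2 := smul_le_smul_of_nonneg_left h1 hc0.le
    rwa [Algebra.algebraMap_eq_smul_one, smul_smul, hc, inv_mul_cancel₀ hN.ne', one_smul,
      ← hc] at h2
  have h := Φ.kadison_of_le_one ha (smul_nonneg hc0.le hd) hd1 (v := c • v) (by
    rw [mul_smul_comm, hv, mul_smul_comm, smul_mul_assoc, Φ.map_smul_real])
  simp only [star_smul, star_trivial, smul_mul_assoc, mul_smul_comm, Φ.map_smul_real] at h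
  rwa [smul_le_smul_iff_of_pos_left hc0, smul_le_smul_iff_of_pos_left hc0] at h

/-! ### Strict positivity, real powers and Choi's inequality -/

lemma isStrictlyPositive_smul_one {c : ℝ} (hc : 0 < c) : IsStrictlyPositive (c • (1 : 𝒜)) :=
  ⟨smul_nonneg hc.le zero_le_one, isUnit_one.smul (Units.mk0 c hc.ne')⟩

lemma IsStrictlyPositive.conj_of_isUnit {a x : 𝒜} (ha : IsSelfAdjoint a) (hau : IsUnit a)
    (hx : IsStrictlyPositive x) : IsStrictlyPositive (a * x * a) :=
  ⟨conj_nonneg_of_isSelfAdjoint ha hx.nonneg, (hau.mul hx.isUnit).mul hau⟩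

lemma conj_le_conj_of_isSelfAdjoint {a x y : 𝒜} (ha : IsSelfAdjoint a) (hxy : x ≤ y) :
    a * x * a ≤ a * y * a := by
  simpa [ha.star_eq] using star_left_conjugate_le_conjugate hxy a

lemma isSelfAdjoint_cfcRpow (a : 𝒜) (p : ℝ) : IsSelfAdjoint (a ^ p) :=
  .of_nonneg CFC.rpow_nonneg

lemma rpow_neg_one_eq_of_mul_eq_one {a b : 𝒜} (ha : IsStrictlyPositive a) (hab : a * b = 1) :
    a ^ (-1 : ℝ) = b := by
  have h := CFC.rpow_neg_mul_rpow (a := a) 1 ha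
  rw [CFC.rpow_one a ha.nonneg] at h
  exact left_inv_eq_right_inv h hab

lemma rpow_half_mul_rpow_half {a : 𝒜} (ha : 0 ≤ a) : a ^ (1 / 2 : ℝ) * a ^ (1 / 2 : ℝ) = a := by
  rw [← CFC.sqrt_eq_rpow, CFC.sqrt_mul_sqrt_self a ha]

lemma rpow_half_eq_of_mul_self {a b : 𝒜} (hb : 0 ≤ b) (h : b * b = a) : a ^ (1 / 2 : ℝ) = b := by
  rw [← CFC.sqrt_eq_rpow, CFC.sqrt_unique h hb]

lemma PositiveLinearMap.isStrictlyPositive_map (Φ : 𝒜 →ₚ[ℂ] ℬ) (hΦ : Φ 1 = 1) {y : 𝒜}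
    (hy : IsStrictlyPositive y) : IsStrictlyPositive (Φ y) := by
  rcases subsingleton_or_nontrivial 𝒜 with h | h
  · rw [Subsingleton.elim y 1, hΦ]
    exact isStrictlyPositive_one
  · obtain ⟨r, hr, hry⟩ := (CFC.exists_pos_algebraMap_le_iff (a := y) (.of_nonneg hy.nonneg)).2
      (CStarAlgebra.isStrictlyPositive_iff_isSelfAdjoint_and_spectrum_pos.1 hy).2
    refine (isStrictlyPositive_smul_one hr).of_le ?_
    have := OrderHomClass.mono Φ hry
    rwa [Algebra.algebraMap_eq_smul_one, Φ.map_smul_real, hΦ] at this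

/-- Choi's inequality `Φ(y)⁻¹ ≤ Φ(y⁻¹)` for unital positive maps. -/
lemma PositiveLinearMap.map_rpow_neg_one_ge (Φ : 𝒜 →ₚ[ℂ] ℬ) (hΦ : Φ 1 = 1) {y : 𝒜}
    (hy : IsStrictlyPositive y) : Φ y ^ (-1 : ℝ) ≤ Φ (y ^ (-1 : ℝ)) := by
  have hΦy := Φ.isStrictlyPositive_map hΦ hy
  have hyy := rpow_half_mul_rpow_half hy.nonneg
  have hinv : Φ y * Φ y ^ (-1 : ℝ) = 1 := by
    simpa [CFC.rpow_one (Φ y) hΦy.nonneg] using CFC.rpow_mul_rpow_neg (a := Φ y) 1 hΦy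
  have e1 : y ^ (1 / 2 : ℝ) * y ^ (-1 : ℝ) * y ^ (1 / 2 : ℝ) = 1 := by
    rw [← CFC.rpow_add hy.isUnit, ← CFC.rpow_add hy.isUnit]
    norm_num [CFC.rpow_zero y hy.nonneg]
  have e2 : y ^ (1 / 2 : ℝ) * (y ^ (-1 : ℝ) * y ^ (-1 : ℝ)) * y ^ (1 / 2 : ℝ) = y ^ (-1 : ℝ) := by
    rw [← CFC.rpow_add hy.isUnit, ← CFC.rpow_add hy.isUnit, ← CFC.rpow_add hy.isUnit]
    norm_num
  have h := Φ.kadison (a := y ^ (1 / 2 : ℝ)) (d := y ^ (-1 : ℝ)) (v := Φ y ^ (-1 : ℝ))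
    (isSelfAdjoint_cfcRpow _ _) CFC.rpow_nonneg (by rw [hyy, e1, hΦ, hinv])
  rwa [hyy, e2, (isSelfAdjoint_cfcRpow _ _).star_eq, mul_assoc, hinv, mul_one] at h

/-! ### Geometric mean: inversion, AM–GM, Ando's inequality -/

/-- The geometric mean of two positive invertible elements of a C⋆-algebra. -/
noncomputable def geomMean (a b : 𝒜) : 𝒜 :=
  a ^ (1 / 2 : ℝ) * (a ^ (-(1 / 2) : ℝ) * b * a ^ (-(1 / 2) : ℝ)) ^ (1 / 2 : ℝ) * a ^ (1 / 2 : ℝ)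

lemma isStrictlyPositive_conj_rpow {a b : 𝒜} (ha : IsStrictlyPositive a)
    (hb : IsStrictlyPositive b) (p : ℝ) : IsStrictlyPositive (a ^ p * b * a ^ p) :=
  hb.conj_of_isUnit (isSelfAdjoint_cfcRpow _ _) (ha.rpow a p).isUnit

lemma isStrictlyPositive_geomMean {a b : 𝒜} (ha : IsStrictlyPositive a)
    (hb : IsStrictlyPositive b) : IsStrictlyPositive (geomMean a b) :=
  isStrictlyPositive_conj_rpow ha ((isStrictlyPositive_conj_rpow ha hb _).rpow _ _) _

lemma geomMean_rpow_neg_one {a b : 𝒜} (ha : IsStrictlyPositive a) (hb : IsStrictlyPositive b) :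
    geomMean (a ^ (-1 : ℝ)) (b ^ (-1 : ℝ)) = geomMean a b ^ (-1 : ℝ) := by
  have h1 := CFC.rpow_mul_rpow_neg (a := a) (1 / 2) ha
  have h2 := CFC.rpow_neg_mul_rpow (a := a) (1 / 2) ha
  have hc := isStrictlyPositive_conj_rpow ha hb (-(1 / 2))
  have hbb : b * b ^ (-1 : ℝ) = 1 := by
    simpa [CFC.rpow_one b hb.nonneg] using CFC.rpow_mul_rpow_neg (a := b) 1 hb
  have hg := isStrictlyPositive_geomMean ha hb
  have e1 : (a ^ (-1 : ℝ)) ^ (1 / 2 : ℝ) = a ^ (-(1 / 2) : ℝ) := by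
    rw [CFC.rpow_rpow a _ _ (by norm_num) ha]; norm_num
  have e2 : (a ^ (-1 : ℝ)) ^ (-(1 / 2) : ℝ) = a ^ (1 / 2 : ℝ) := by
    rw [CFC.rpow_rpow a _ _ (by norm_num) ha]; norm_num
  unfold geomMean at hg ⊢
  rw [e1, e2]
  set u := a ^ (1 / 2 : ℝ)
  set w := a ^ (-(1 / 2) : ℝ)
  set c := w * b * w with hcdef
  have e3 : u * b ^ (-1 : ℝ) * u = c ^ (-1 : ℝ) := by
    refine (rpow_neg_one_eq_of_mul_eq_one hc ?_).symm
    calc c * (u * b ^ (-1 : ℝ) * u) = w * b * (w * u) * b ^ (-1 : ℝ) * u := by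
          simp only [hcdef, mul_assoc]
      _ = w * (b * b ^ (-1 : ℝ)) * u := by rw [h2]; simp only [mul_one, mul_assoc]
      _ = 1 := by rw [hbb, mul_one, h2]
  have e4 : (c ^ (-1 : ℝ)) ^ (1 / 2 : ℝ) = c ^ (-(1 / 2) : ℝ) := by
    rw [CFC.rpow_rpow c _ _ (by norm_num) hc]; norm_num
  rw [e3, e4]
  refine (rpow_neg_one_eq_of_mul_eq_one hg ?_).symm
  calc u * c ^ (1 / 2 : ℝ) * u * (w * c ^ (-(1 / 2) : ℝ) * w)
      = u * c ^ (1 / 2 : ℝ) * (u * w) * c ^ (-(1 / 2) : ℝ) * w := by simp only [mul_assoc]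
    _ = u * (c ^ (1 / 2 : ℝ) * c ^ (-(1 / 2) : ℝ)) * w := by
      rw [h1]; simp only [mul_one, mul_assoc]
    _ = 1 := by rw [CFC.rpow_mul_rpow_neg _ hc, mul_one, h1]

/-- The arithmetic-geometric mean inequality. -/
lemma geomMean_le_arithMean {a b : 𝒜} (ha : IsStrictlyPositive a) (hb : IsStrictlyPositive b) :
    geomMean a b ≤ (1 / 2 : ℝ) • a + (1 / 2 : ℝ) • b := by
  have h1 := CFC.rpow_mul_rpow_neg (a := a) (1 / 2) ha
  have h2 := CFC.rpow_neg_mul_rpow (a := a) (1 / 2) ha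
  have hc := isStrictlyPositive_conj_rpow ha hb (-(1 / 2))
  have haa := rpow_half_mul_rpow_half ha.nonneg
  unfold geomMean
  set u := a ^ (1 / 2 : ℝ) with hu
  set w := a ^ (-(1 / 2) : ℝ)
  set c := w * b * w with hcdef
  have hcc := rpow_half_mul_rpow_half hc.nonneg
  set t := c ^ (1 / 2 : ℝ) with ht
  -- This is the scalar proof `2t ≤ 1 + t²` for `t = c ^ (1 / 2)`; conjugation by `a ^ (1 / 2)` then
  -- sends `1` to `a` and `c` to `b`.
  have hsq : 0 ≤ (1 - t) * (1 - t) :=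
    ((IsSelfAdjoint.one 𝒜).sub (isSelfAdjoint_cfcRpow c (1 / 2))).mul_self_nonneg
  have hle : t ≤ (1 / 2 : ℝ) • 1 + (1 / 2 : ℝ) • c := by
    rw [← sub_nonneg]
    refine (smul_nonneg (by norm_num : (0 : ℝ) ≤ 1 / 2) hsq).trans_eq ?_
    rw [← hcc]
    simp only [sub_mul, mul_sub, one_mul, mul_one]
    module
  refine (conj_le_conj_of_isSelfAdjoint (isSelfAdjoint_cfcRpow a (1 / 2)) hle).trans_eq ?_
  have hub : u * c * u = b := by
    calc u * c * u = (u * w) * b * (w * u) := by simp only [hcdef, mul_assoc]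
      _ = b := by rw [h1, h2, one_mul, mul_one]
  rw [← hu]
  simp only [mul_add, add_mul, mul_smul_comm, smul_mul_assoc, mul_one, haa, hub]

/-- Ando's inequality `Φ(a ♯ b) ≤ Φ(a) ♯ Φ(b)` for unital positive maps. -/
lemma PositiveLinearMap.map_geomMean_le (Φ : 𝒜 →ₚ[ℂ] ℬ) (hΦ : Φ 1 = 1) {a b : 𝒜}
    (ha : IsStrictlyPositive a) (hb : IsStrictlyPositive b) :
    Φ (geomMean a b) ≤ geomMean (Φ a) (Φ b) := by
  have hR := Φ.isStrictlyPositive_map hΦ ha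
  have hG := (Φ.isStrictlyPositive_map hΦ (isStrictlyPositive_geomMean ha hb)).nonneg
  have h1 := CFC.rpow_mul_rpow_neg (a := a) (1 / 2) ha
  have h2 := CFC.rpow_neg_mul_rpow (a := a) (1 / 2) ha
  have hc := isStrictlyPositive_conj_rpow ha hb (-(1 / 2))
  have hcc := rpow_half_mul_rpow_half hc.nonneg
  have haa := rpow_half_mul_rpow_half ha.nonneg
  have hub : a ^ (1 / 2 : ℝ) * (a ^ (-(1 / 2) : ℝ) * b * a ^ (-(1 / 2) : ℝ)) * a ^ (1 / 2 : ℝ)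
      = b := by
    calc _ = (a ^ (1 / 2 : ℝ) * a ^ (-(1 / 2) : ℝ)) * b * (a ^ (-(1 / 2) : ℝ) * a ^ (1 / 2 : ℝ)) := by
          simp only [mul_assoc]
      _ = b := by rw [h1, h2, one_mul, mul_one]
  have r1 := CFC.rpow_mul_rpow_neg (a := Φ a) (1 / 2) hR
  have r2 := CFC.rpow_neg_mul_rpow (a := Φ a) (1 / 2) hR
  have hinv : Φ a * Φ a ^ (-1 : ℝ) = 1 := by
    simpa [CFC.rpow_one (Φ a) hR.nonneg] using CFC.rpow_mul_rpow_neg (a := Φ a) 1 hR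
  have hss : Φ a ^ (-(1 / 2) : ℝ) * Φ a ^ (-(1 / 2) : ℝ) = Φ a ^ (-1 : ℝ) := by
    rw [← CFC.rpow_add hR.isUnit]; norm_num
  set T := Φ (geomMean a b) with hT
  have hTsa : IsSelfAdjoint T := .of_nonneg hG
  -- With this weight `ada = a ♯ b` and `ad²a = b`, so Kadison reads `T Φ(a)⁻¹ T ≤ Φ(b)`.
  -- Conjugating by `Φ(a) ^ (-1/2)` makes the left side a square, and the operator monotone square
  -- root finishes.
  have hK := Φ.kadison (a := a ^ (1 / 2 : ℝ))
    (d := (a ^ (-(1 / 2) : ℝ) * b * a ^ (-(1 / 2) : ℝ)) ^ (1 / 2 : ℝ))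
    (v := Φ a ^ (-1 : ℝ) * T) (isSelfAdjoint_cfcRpow _ _) CFC.rpow_nonneg
    (by rw [haa, ← mul_assoc, hinv, one_mul]; rfl)
  rw [haa, hcc, hub, star_mul, hTsa.star_eq, (isSelfAdjoint_cfcRpow _ _).star_eq, mul_assoc,
    ← mul_assoc (Φ a), hinv, one_mul] at hK
  unfold geomMean
  set r := Φ a ^ (1 / 2 : ℝ) with hr
  set s := Φ a ^ (-(1 / 2) : ℝ) with hs
  have hssa : IsSelfAdjoint s := isSelfAdjoint_cfcRpow _ _
  have hz : 0 ≤ s * T * s := conj_nonneg_of_isSelfAdjoint hssa hG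
  have hzz : (s * T * s) * (s * T * s) ≤ s * Φ b * s := by
    refine (le_of_eq ?_).trans (conj_le_conj_of_isSelfAdjoint hssa hK)
    rw [← hss]
    simp only [mul_assoc]
  have hroot := CFC.rpow_le_rpow (p := 1 / 2) ⟨by norm_num, by norm_num⟩ hzz
  rw [rpow_half_eq_of_mul_self hz rfl] at hroot
  refine (le_of_eq ?_).trans
    (conj_le_conj_of_isSelfAdjoint (isSelfAdjoint_cfcRpow (Φ a) (1 / 2)) hroot)
  calc T = (r * s) * T * (s * r) := by rw [r1, r2, one_mul, mul_one]
    _ = r * (s * T * s) * r := by simp only [mul_assoc]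

/-! ### From an additive bound to powers -/

/-- The Bhatia–Kittaneh inequality `‖a b‖ ≤ ‖a + b‖² / 4`, in order form and normalised. -/
lemma mul_mul_mul_le_of_add_le_one {a b : 𝒜} (ha : 0 ≤ a) (hb : 0 ≤ b) (hab : a + b ≤ 1) :
    b * (a * a) * b ≤ (1 / 16 : ℝ) • 1 := by
  have hasa : IsSelfAdjoint a := .of_nonneg ha
  have hbsa : IsSelfAdjoint b := .of_nonneg hb
  -- Sum-of-squares certificate. `w = ax + b` is the critical point in `w` of `p1 + p2 + p3`; with
  -- it, `p1` to `p5` add up to `1/4 - x*ab - bax + x*x/4`, which `x = 4ab` minimises to `1/4 -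
  -- 4ba²b`.
  set x : 𝒜 := (4 : ℝ) • (a * b) with hx
  set w : 𝒜 := a * x + b with hw
  set e : 𝒜 := (1 / 2 : ℝ) • 1 with he
  have hsx : star x = (4 : ℝ) • (b * a) := by
    simp [hx, star_smul, hasa.star_eq, hbsa.star_eq]
  have hsw : star w = star x * a + b := by
    simp [hw, hasa.star_eq, hbsa.star_eq]
  have hesa : IsSelfAdjoint e := by simp [he, IsSelfAdjoint, star_smul]
  have p1 := star_left_conjugate_nonneg ha (x - w)
  have p2 := star_left_conjugate_nonneg hb (1 - w)
  have p3 := star_left_conjugate_nonneg (sub_nonneg.2 hab) w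
  have p4 := star_left_conjugate_nonneg (hasa.sub hesa).mul_self_nonneg x
  have p5 := (hbsa.sub hesa).mul_self_nonneg
  have hsum := smul_nonneg (by norm_num : (0 : ℝ) ≤ 1 / 4)
    (add_nonneg (add_nonneg (add_nonneg (add_nonneg p1 p2) p3) p4) p5)
  rw [← sub_nonneg]
  refine hsum.trans_eq ?_
  simp only [star_sub, star_one, hsw, hsx]
  simp only [hw, hx, he, sub_mul, mul_sub, add_mul, mul_add, smul_mul_assoc, mul_smul_comm,
    one_mul, mul_one, mul_assoc]
  module

lemma rpow_le_self_of_le_one {a : 𝒜} (ha : 0 ≤ a) (ha1 : a ≤ 1) {r : ℝ} (hr : 1 ≤ r) :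
    a ^ r ≤ a := by
  have hsa : IsSelfAdjoint a := .of_nonneg ha
  have ha1' : a ≤ algebraMap ℝ 𝒜 1 := by simpa using ha1
  rw [CFC.rpow_eq_cfc_real ha]
  conv_rhs => rw [← cfc_id' ℝ a]
  refine cfc_mono (fun x hx ↦ ?_)
    (continuousOn_id.rpow_const fun _ _ ↦ Or.inr (by linarith))
  have h0 : 0 ≤ x := spectrum_nonneg_of_nonneg ha hx
  have h1 : x ≤ 1 := (le_algebraMap_iff_spectrum_le (ha := hsa)).1 ha1' x hx
  simpa using Real.rpow_le_rpow_of_exponent_ge' h0 h1 zero_le_one hr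

lemma smul_rpow_of_nonneg {a : 𝒜} (ha : 0 ≤ a) {c : ℝ} (hc : 0 ≤ c) {r : ℝ} (hr : 0 ≤ r) :
    (c • a) ^ r = c ^ r • a ^ r := by
  have hsa : IsSelfAdjoint a := .of_nonneg ha
  have hcont (s : Set ℝ) : ContinuousOn (fun x : ℝ ↦ x ^ r) s :=
    continuousOn_id.rpow_const fun _ _ ↦ Or.inr hr
  rw [CFC.rpow_eq_cfc_real ha, CFC.rpow_eq_cfc_real (smul_nonneg hc ha),
    ← cfc_smul (c ^ r) (fun x : ℝ ↦ x ^ r) a (hcont _)]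
  rw [← cfc_comp_smul c (fun x : ℝ ↦ x ^ r) a (hcont _)]
  refine cfc_congr fun x hx ↦ ?_
  simp [Real.mul_rpow hc (spectrum_nonneg_of_nonneg ha hx)]

/-- From `a + k b⁻¹ ≤ s` one gets a comparison of `p`-th powers for every `p ≥ 2`. -/
lemma rpow_le_rpow_of_add_smul_inv_le_of_two_le {a b : 𝒜} (ha : 0 ≤ a) (hb : IsStrictlyPositive b)
    {k s : ℝ} (hk : 0 < k) (hs : 0 < s) (h : a + k • b ^ (-1 : ℝ) ≤ s • 1) {p : ℝ} (hp : 2 ≤ p) :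
    a ^ p ≤ (s ^ (2 * p) / (16 * k ^ p)) • b ^ p := by
  have hr : 1 ≤ p / 2 := by linarith
  have hr0 : 0 ≤ p / 2 := by linarith
  set r := p / 2 with hrdef
  set x : 𝒜 := s⁻¹ • a with hx
  set y : 𝒜 := (s⁻¹ * k) • b ^ (-1 : ℝ) with hy
  have hx0 : 0 ≤ x := smul_nonneg (by positivity) ha
  have hy0 : 0 ≤ y := smul_nonneg (by positivity) CFC.rpow_nonneg
  have hxy : x + y ≤ 1 := by
    have := smul_le_smul_of_nonneg_left h (inv_nonneg.2 hs.le)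
    rwa [smul_add, smul_smul, smul_smul, inv_mul_cancel₀ hs.ne', one_smul] at this
  have hx1 : x ≤ 1 := (le_add_of_nonneg_right hy0).trans hxy
  have hy1 : y ≤ 1 := (le_add_of_nonneg_left hx0).trans hxy
  -- Since `r ≥ 1`, powers only shrink elements between `0` and `1`, so no operator convexity is
  -- needed.
  have hsum : x ^ r + y ^ r ≤ 1 :=
    (add_le_add (rpow_le_self_of_le_one hx0 hx1 hr) (rpow_le_self_of_le_one hy0 hy1 hr)).trans hxy
  have hmain := mul_mul_mul_le_of_add_le_one CFC.rpow_nonneg CFC.rpow_nonneg hsum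
  have hyr : y ^ r = (s⁻¹ * k) ^ r • b ^ (-r) := by
    rw [hy, smul_rpow_of_nonneg CFC.rpow_nonneg (by positivity) hr0,
      CFC.rpow_rpow b _ _ (by norm_num) hb, neg_one_mul]
  have hxr : x ^ r * x ^ r = (s⁻¹) ^ p • a ^ p := by
    rw [hx, smul_rpow_of_nonneg ha (by positivity) hr0, smul_mul_smul_comm,
      ← Real.rpow_add (by positivity)]
    congr 1
    · congr 1; ring
    · have h2 := CFC.rpow_rpow_of_exponent_nonneg a r 2 hr0 zero_le_two ha
      have h3 := CFC.rpow_natCast (a ^ r) 2 CFC.rpow_nonneg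
      rw [← pow_two, ← h3, Nat.cast_ofNat, h2]
      congr 1; ring
  -- `y ^ r` is a multiple of `b ^ (-r)`; conjugating by `b ^ r` isolates `a ^ p` against `b ^ (2r)
  -- = b ^ p`.
  have hconj := conj_le_conj_of_isSelfAdjoint (isSelfAdjoint_cfcRpow b r) hmain
  have b1 := CFC.rpow_mul_rpow_neg (a := b) r hb
  have b2 := CFC.rpow_neg_mul_rpow (a := b) r hb
  have hbb : b ^ r * b ^ r = b ^ p := by
    rw [← CFC.rpow_add hb.isUnit]; congr 1; ring
  have hlhs : b ^ r * (b ^ (-r) * a ^ p * b ^ (-r)) * b ^ r = a ^ p := by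
    calc _ = (b ^ r * b ^ (-r)) * a ^ p * (b ^ (-r) * b ^ r) := by simp only [mul_assoc]
      _ = a ^ p := by rw [b1, b2, one_mul, mul_one]
  rw [hyr, hxr] at hconj
  simp only [smul_mul_assoc, mul_smul_comm, smul_smul, mul_one, hlhs, hbb] at hconj
  have hkp : (s⁻¹ * k) ^ r * (s⁻¹ * k) ^ r = (s ^ p)⁻¹ * k ^ p := by
    rw [← Real.rpow_add (by positivity), Real.mul_rpow (by positivity) hk.le,
      Real.inv_rpow hs.le, hrdef, add_halves]
  have hc : 0 ≤ s ^ p * s ^ p / k ^ p := by positivity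
  have hfin := smul_le_smul_of_nonneg_left hconj hc
  rw [smul_smul, smul_smul] at hfin
  have hsp : 0 < s ^ p := Real.rpow_pos_of_pos hs p
  have hkp0 : 0 < k ^ p := Real.rpow_pos_of_pos hk p
  refine (le_of_eq ?_).trans (hfin.trans_eq ?_)
  · rw [Real.inv_rpow hs.le]
    refine (one_smul ℝ (a ^ p)).symm.trans (congrArg (· • a ^ p) ?_)
    have : s ^ p * s ^ p / k ^ p * (((s⁻¹ * k) ^ r * (s⁻¹ * k) ^ r) * (s ^ p)⁻¹) = 1 := by
      rw [hkp]; field_simp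
    rw [← this]; ring
  · congr 1
    rw [two_mul, Real.rpow_add hs]
    field_simp

/-- Each entry of the maximum serves one range: the second for `p ≥ 2`, where `(4 ^ (2 / p)) ^ p =
16`, and the first for `p ≤ 2`, by raising the `p = 2` estimate to the operator monotone power `p /
2`. -/
lemma rpow_le_amgmConst_smul_rpow {a b : 𝒜} (ha : 0 ≤ a) (hb : IsStrictlyPositive b)
    {m M : ℝ} (hm : 0 < m) (hM : 0 < M)
    (h : a + (M * m) • b ^ (-1 : ℝ) ≤ (M + m) • 1) {p : ℝ} (hp : 0 < p) :
    a ^ p ≤ amgmConst m M p ^ p • b ^ p := by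
  have hMm : 0 < M * m := by positivity
  have hS : 0 < M + m := by positivity
  rcases le_total 2 p with hp2 | hp2
  · refine (rpow_le_rpow_of_add_smul_inv_le_of_two_le ha hb hMm hS h hp2).trans ?_
    refine smul_le_smul_of_nonneg_right ?_ CFC.rpow_nonneg
    refine (le_of_eq ?_).trans (Real.rpow_le_rpow (by positivity) (le_max_right _ _) hp.le)
    have h4 : ((4 : ℝ) ^ (2 / p)) ^ p = 16 := by
      rw [← Real.rpow_mul (by norm_num), div_mul_cancel₀ _ hp.ne']; norm_num
    rw [Real.div_rpow (by positivity) (by positivity), mul_assoc ((4 : ℝ) ^ (2 / p)),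
      Real.mul_rpow (x := (4 : ℝ) ^ (2 / p)) (by positivity) hMm.le, h4, Real.rpow_mul hS.le]
    norm_num
  · have h2 := rpow_le_rpow_of_add_smul_inv_le_of_two_le ha hb hMm hS h le_rfl
    have hle := CFC.rpow_le_rpow (p := p / 2) ⟨by linarith, by linarith⟩ h2
    have hp2' : 2 * (p / 2) = p := by ring
    rw [smul_rpow_of_nonneg CFC.rpow_nonneg (by positivity) (by positivity),
      CFC.rpow_rpow_of_exponent_nonneg a 2 _ zero_le_two (by positivity) ha,
      CFC.rpow_rpow_of_exponent_nonneg b 2 _ zero_le_two (by positivity) hb.nonneg, hp2'] at hle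
    refine hle.trans (smul_le_smul_of_nonneg_right ?_ CFC.rpow_nonneg)
    refine (le_of_eq ?_).trans (Real.rpow_le_rpow (by positivity) (le_max_left _ _) hp.le)
    have e : (M + m) ^ (2 * 2 : ℝ) / (16 * (M * m) ^ (2 : ℝ))
        = ((M + m) ^ 2 / (4 * M * m)) ^ (2 : ℝ) := by
      rw [Real.rpow_mul hS.le]
      norm_num
      ring
    rw [e, ← Real.rpow_mul (by positivity), hp2']

/-! ### Refined mean and conclusion -/

/-- `(M - a)(a - m) ≥ 0`, divided by `a`. -/
lemma add_smul_rpow_neg_one_le {a : 𝒜} {m M : ℝ} (hm : 0 < m) (hma : m • 1 ≤ a)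
    (haM : a ≤ M • 1) : a + (M * m) • a ^ (-1 : ℝ) ≤ (M + m) • 1 := by
  have ha := (isStrictlyPositive_smul_one hm).of_le hma
  have hsa : IsSelfAdjoint a := .of_nonneg ha.nonneg
  have hinv : a ^ (-1 : ℝ) = cfc (fun x : ℝ ↦ x ^ (-1 : ℝ)) a := CFC.rpow_eq_cfc_real ha.nonneg
  have hm' : algebraMap ℝ 𝒜 m ≤ a := by rwa [Algebra.algebraMap_eq_smul_one]
  have hM' : a ≤ algebraMap ℝ 𝒜 M := by rwa [Algebra.algebraMap_eq_smul_one]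
  have hspec : ∀ x ∈ spectrum ℝ a, m ≤ x ∧ x ≤ M := fun x hx ↦
    ⟨(algebraMap_le_iff_le_spectrum (ha := hsa)).1 hm' x hx,
      (le_algebraMap_iff_spectrum_le (ha := hsa)).1 hM' x hx⟩
  have hcont : ContinuousOn (fun x : ℝ ↦ x ^ (-1 : ℝ)) (spectrum ℝ a) :=
    continuousOn_id.rpow_const fun x hx ↦ Or.inl (hm.trans_le (hspec x hx).1).ne'
  have hcont' : ContinuousOn (fun x : ℝ ↦ (M * m) • x ^ (-1 : ℝ)) (spectrum ℝ a) :=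
    (continuous_const_smul (M * m)).comp_continuousOn' hcont
  rw [hinv, ← cfc_smul (M * m) _ a hcont]
  nth_rewrite 1 [← cfc_id' ℝ a]
  rw [← cfc_add (a := a) (fun x ↦ x) (fun x ↦ (M * m) • x ^ (-1 : ℝ)) continuousOn_id hcont',
    ← Algebra.algebraMap_eq_smul_one]
  refine cfc_le_algebraMap _ _ _ (fun x hx ↦ ?_) (continuousOn_id.add hcont')
  obtain ⟨h1, h2⟩ := hspec x hx
  have hx0 : 0 < x := hm.trans_le h1
  rw [Real.rpow_neg_one, smul_eq_mul, ← sub_nonneg]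
  have : M + m - (x + M * m * x⁻¹) = (M - x) * (x - m) * x⁻¹ := by field_simp; ring
  rw [this]
  exact mul_nonneg (mul_nonneg (by linarith) (by linarith)) (inv_nonneg.2 hx0.le)

/-- Inversion reverses order, so enlarging `Φ (geomMean a b)` to `g` only helps the additive bound;
leaving `g` free covers both claims at once. -/
lemma PositiveLinearMap.rpow_refinedArithMean_le (Φ : 𝒜 →ₚ[ℂ] ℬ) (hΦ : Φ 1 = 1) {a b : 𝒜}
    {m M : ℝ} (hm : 0 < m) (hM : 0 < M) (hma : m • 1 ≤ a) (haM : a ≤ M • 1) (hmb : m • 1 ≤ b)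
    (hbM : b ≤ M • 1) {p : ℝ} (hp : 0 < p) {g : ℬ} (hg : Φ (geomMean a b) ≤ g) :
    Φ ((1 / 2 : ℝ) • a + (1 / 2 : ℝ) • b + (M * m) • ((1 / 2 : ℝ) • a ^ (-1 : ℝ)
      + (1 / 2 : ℝ) • b ^ (-1 : ℝ) - geomMean (a ^ (-1 : ℝ)) (b ^ (-1 : ℝ)))) ^ p
      ≤ amgmConst m M p ^ p • g ^ p := by
  have ha := (isStrictlyPositive_smul_one hm).of_le hma
  have hb := (isStrictlyPositive_smul_one hm).of_le hmb
  have hG := isStrictlyPositive_geomMean ha hb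
  have hΦG := Φ.isStrictlyPositive_map hΦ hG
  refine rpow_le_amgmConst_smul_rpow (map_nonneg Φ ?_) (hΦG.of_le hg) hm hM ?_ hp
  · exact add_nonneg (add_nonneg (smul_nonneg (by norm_num) ha.nonneg)
      (smul_nonneg (by norm_num) hb.nonneg)) (smul_nonneg (by positivity)
      (sub_nonneg.2 (geomMean_le_arithMean (ha.rpow a _) (hb.rpow b _))))
  · have hge : g ^ (-1 : ℝ) ≤ Φ (geomMean a b ^ (-1 : ℝ)) :=
      (CStarAlgebra.rpow_neg_one_le_rpow_neg_one hg hΦG).trans (Φ.map_rpow_neg_one_ge hΦ hG)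
    refine (add_le_add_right (smul_le_smul_of_nonneg_left hge (by positivity : 0 ≤ M * m)) _).trans
      ?_
    rw [← Φ.map_smul_real, ← map_add, ← hΦ, ← Φ.map_smul_real]
    refine OrderHomClass.mono Φ ?_
    -- The subtracted mean of inverses now cancels the added `(M * m) • geomMean a b ^ (-1)`.
    rw [geomMean_rpow_neg_one ha hb]
    have h1 := smul_le_smul_of_nonneg_left (add_le_add (add_smul_rpow_neg_one_le hm hma haM)
      (add_smul_rpow_neg_one_le hm hmb hbM)) (by norm_num : (0 : ℝ) ≤ 1 / 2)
    refine (le_of_eq ?_).trans (h1.trans_eq ?_) <;> module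

end CStar

theorem corollary2p11
    {H : Type*} [NormedAddCommGroup H] [InnerProductSpace ℂ H] [CompleteSpace H]
    {K : Type*} [NormedAddCommGroup K] [InnerProductSpace ℂ K] [CompleteSpace K]
    (Φ : (H →L[ℂ] H) →ₚ[ℂ] (K →L[ℂ] K)) (hΦ : Φ 1 = 1)
    (A B : H →L[ℂ] H) (m M : ℝ) (hm : 0 < m)
    (hmA : m • (1 : H →L[ℂ] H) ≤ A) (hAM : A ≤ M • (1 : H →L[ℂ] H))
    (hmB : m • (1 : H →L[ℂ] H) ≤ B) (hBM : B ≤ M • (1 : H →L[ℂ] H))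
    (p : ℝ) (hp : 0 < p) :
    Φ (opArithMean (1 / 2) A B + (M * m) •
          (opArithMean (1 / 2) (Ring.inverse A) (Ring.inverse B)
            - opGeomMean (1 / 2) (Ring.inverse A) (Ring.inverse B))) ^ p
        ≤ amgmConst m M p ^ p • Φ (opGeomMean (1 / 2) A B) ^ p ∧
      Φ (opArithMean (1 / 2) A B + (M * m) •
          (opArithMean (1 / 2) (Ring.inverse A) (Ring.inverse B)
            - opGeomMean (1 / 2) (Ring.inverse A) (Ring.inverse B))) ^ p
        ≤ amgmConst m M p ^ p • opGeomMean (1 / 2) (Φ A) (Φ B) ^ p := by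
  -- `0 < M` follows from the operator bounds only if `1 ≠ 0`; otherwise `Φ 1 = 1` makes the target
  -- trivial too.
  rcases subsingleton_or_nontrivial (H →L[ℂ] H) with hH | hH
  · have h10 : (1 : K →L[ℂ] K) = 0 := by rw [← hΦ, Subsingleton.elim (1 : H →L[ℂ] H) 0, map_zero]
    have : Subsingleton (K →L[ℂ] K) := subsingleton_of_zero_eq_one h10.symm
    exact ⟨(Subsingleton.elim _ _).le, (Subsingleton.elim _ _).le⟩
  have hM : 0 < M := by
    by_contra! hM
    have h0 : M • (1 : H →L[ℂ] H) ≤ 0 := smul_nonpos_of_nonpos_of_nonneg hM zero_le_one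
    have h1 : m • (1 : H →L[ℂ] H) = 0 :=
      le_antisymm ((hmA.trans hAM).trans h0) (smul_nonneg hm.le zero_le_one)
    exact (smul_ne_zero hm.ne' one_ne_zero) h1
  have hA := (isStrictlyPositive_smul_one hm).of_le hmA
  have hB := (isStrictlyPositive_smul_one hm).of_le hmB
  have hmean (X Y : H →L[ℂ] H) : opArithMean (1 / 2) X Y = (1 / 2 : ℝ) • X + (1 / 2 : ℝ) • Y := by
    rw [opArithMean]; norm_num
  rw [hmean, hmean, CFC.inverse_eq_rpow_neg_one hA, CFC.inverse_eq_rpow_neg_one hB]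
  exact ⟨Φ.rpow_refinedArithMean_le hΦ hm hM hmA hAM hmB hBM hp le_rfl,
    Φ.rpow_refinedArithMean_le hΦ hm hM hmA hAM hmB hBM hp (Φ.map_geomMean_le hΦ hA hB)⟩
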